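/- **Setting.** Let $k\ge 2$ be the number of treatments and let $\theta=(\theta^1,\dots,\theta^k)\in[0,1]^k$. In each of $T$ waves of unit size ($N=1$), an algorithm assigns one unit to a treatment $d\in\{1,\dots,k\}$, chosen (possibly at random) on the basis of the past treatments and outcomes, and observes an independent Bernoulli outcome with mean $\theta^{d}$. After wave $T$ it implements a policy $d^*_T\in\{1,\dots,k\}$, chosen (possibly at random) on the basis of all $T$ observations. The algorithm may depend on $T$ and $k$, but not on the unknown $\theta$. Its expected policy (simple) regret is $$R_\theta(T)=\sum_{d=1}^k \Delta^d\,\mathbb P_\theta(d^*_T=d),\qquad \Delta^d=\max_{d'}\theta^{d'}-\theta^d .$$ If $\theta$ has a unique best treatment $b$, let $\Gamma^*(\theta)$ be the maximal $\Gamma\in\mathbb R$ for which there is $\rho\in[0,1]^k$ with $\sum_j\rho^j=1$, $\rho^{b}=1/2$ and, for all $j\ne b$, $$\Gamma\le \min_{x\in[\theta^j,\theta^b]}\big(\rho^b d_{\mathrm{KL}}(x,\theta^b)+\rho^j d_{\mathrm{KL}}(x,\theta^j)\big),$$ where $d_{\mathrm{KL}}(p,q)=p\log\frac pq+(1-p)\log\frac{1-p}{1-q}$.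 **Problem instances.** Let $f^d=d/(4k)$. Instance $1$ is $\theta_{(1)}$ with $\theta^1_{(1)}=1/2$ and $\theta^{d}_{(1)}=1/2-f^d$ for $d\ne1$. For $2\le d\le k$, instance $d$ is $\theta_{(d)}$ with $\theta^{d}_{(d)}=1/2+f^d$ and $\theta^{d'}_{(d)}=\theta^{d'}_{(1)}$ for $d'\ne d$. In instance $d$, treatment $d$ is the unique best one. **Theorem (Lower bound on the expected policy regret).** Let $k\ge2$ and $C=800$. 1. There is a $T_0$, depending only on $k$, such that for every $T>T_0$ and every algorithm with horizon $T$ there is an instance $d\in\{1,\dots,k\}$ with $$R_{\theta_{(d)}}(T)\ \ge\ \exp\Big(-\frac{C}{\log k}\,\Gamma^*(\theta_{(d)})\,T\Big),$$ and hence also $$-\frac1T\log R_{\theta_{(d)}}(T)\ \le\ \frac{C}{\log k}\,\Gamma^*(\theta_{(d)}).$$ 2. For every sequence of algorithms, one for each horizon $T$, there is a fixed instance $d$ for which the first inequality of part 1 holds for infinitely many $T$. 3. Consequently, if $\log k>C$, no sequence of algorithms (one for each horizon $T$) satisfies $-\frac1T\log R_{\theta_{(d)}}(T)\to\Gamma^*(\theta_{(d)})$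 as $T\to\infty$ for every instance $d\in\{1,\dots,k\}$. This contradicts Theorem 1(3) of Kasy–Sautmann, which asserts that exploration sampling attains the exponent $\Gamma^*$. -/

import Mathlib

open scoped unitInterval

noncomputable section

namespace PolicyChoice

/-- The record of the first `t` units (unit wave size): for each unit the treatment it was
assigned to and its binary outcome (`true` is a success). -/
abbrev History (k t : ℕ) : Type := Fin t → Fin k × Bool

/-- A (possibly randomized) adaptive algorithm for `k` treatments and horizon `T`, with unit wave
size. `assign t h` is the law of the treatment given to unit `t` (counted from `0`) when the record
so far is `h`; only `t < T` is ever used. `recommend h` is the law of the policy implemented after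
all `T` units have been observed. All choices may depend on `T`, and none on the means. -/
structure Algorithm (k T : ℕ) where
  assign : (t : ℕ) → History k t → PMF (Fin k)
  recommend : History k T → PMF (Fin k)

/-- Law of a binary outcome whose success probability is `p`. -/
def outcomeLaw (p : I) : PMF Bool :=
  (ProbabilityTheory.bernoulliMeasure true false p).toPMF

namespace Algorithm

variable {k T : ℕ}

/-- Law of the record of the first `t` units when the algorithm `A` faces treatments with mean
outcomes `θ`: the next treatment is drawn from `A.assign`, and its outcome is an independent
Bernoulli variable with the mean of that treatment. -/
def historyLaw (A : Algorithm k T) (θ : Fin k → I) : (t : ℕ) → PMF (History k t)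
  | 0 => PMF.pure Fin.elim0
  | t + 1 =>
    (A.historyLaw θ t).bind fun h =>
      (A.assign t h).bind fun d =>
        (outcomeLaw (θ d)).bind fun y =>
          PMF.pure (Fin.snoc h (d, y))

/-- Law of the implemented policy. -/
def policyLaw (A : Algorithm k T) (θ : Fin k → I) : PMF (Fin k) :=
  (A.historyLaw θ T).bind A.recommend

/-- Expected policy (simple) regret `∑ d, Δ d * P(implemented policy = d)`, where
`Δ d = max θ - θ d`. -/
def regret (A : Algorithm k T) (θ : Fin k → I) : ℝ :=
  ∑ d, ((⨆ d', (θ d' : ℝ)) - θ d) * (A.policyLaw θ d).toReal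

end Algorithm

/-- Kullback-Leibler divergence between the Bernoulli laws with means `p` and `q`. -/
def dKL (p q : ℝ) : ℝ :=
  p * Real.log (p / q) + (1 - p) * Real.log ((1 - p) / (1 - q))

/-- `min` over `x ∈ [θ j, θ b]` of `ρ b * dKL x (θ b) + ρ j * dKL x (θ j)`. -/
def rateG {k : ℕ} (θ : Fin k → I) (b : Fin k) (ρ : Fin k → ℝ) (j : Fin k) : ℝ :=
  sInf ((fun x : ℝ => ρ b * dKL x (θ b) + ρ j * dKL x (θ j)) '' Set.Icc (θ j : ℝ) (θ b : ℝ))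

/-- The exponent `Γ*(θ)`, where `b` is the unique best treatment under `θ`: the largest `Γ` such
that `Γ ≤ rateG θ b ρ j` for all `j ≠ b`, for some vector `ρ` of assignment shares that gives
share `1/2` to `b`. -/
def GammaStar {k : ℕ} (θ : Fin k → I) (b : Fin k) : ℝ :=
  sSup {Γ : ℝ | ∃ ρ : Fin k → ℝ, (∀ j, 0 ≤ ρ j) ∧ ∑ j, ρ j = 1 ∧ ρ b = 1 / 2 ∧
    ∀ j, j ≠ b → Γ ≤ rateG θ b ρ j}

/-- The shift `f^d = d / (4k)`; the treatments `1, …, k` are the elements `0, …, k - 1` of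
`Fin k`. -/
def shift (k : ℕ) (d : Fin k) : ℝ := ((d : ℝ) + 1) / (4 * k)

theorem shift_pos {k : ℕ} (d : Fin k) : 0 < shift k d := by
  have hk : (0 : ℝ) < k := by exact_mod_cast d.pos
  unfold shift
  positivity

theorem shift_le {k : ℕ} (d : Fin k) : shift k d ≤ 1 / 4 := by
  have hk : (0 : ℝ) < k := by exact_mod_cast d.pos
  have hd : (d : ℝ) + 1 ≤ k := by exact_mod_cast d.isLt
  unfold shift
  rw [div_le_iff₀ (by positivity)]
  linarith

/-- The means of instance `1`: treatment `1` has mean `1/2`, and every other treatment `d` has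
mean `1/2 - f^d`. -/
def baseMean (k : ℕ) (j : Fin k) : ℝ :=
  if (j : ℕ) = 0 then 1 / 2 else 1 / 2 - shift k j

/-- The means of instance `d`: those of instance `1`, except that for `d ≠ 1` the mean of
treatment `d` is replaced by `1/2 + f^d`. -/
def instanceMean (k : ℕ) (d : Fin k) : Fin k → ℝ :=
  if (d : ℕ) = 0 then baseMean k else Function.update (baseMean k) d (1 / 2 + shift k d)

theorem instanceMean_mem {k : ℕ} (d j : Fin k) : instanceMean k d j ∈ I := by
  have h1 := shift_pos j
  have h2 := shift_le j
  have h3 := shift_pos d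
  have h4 := shift_le d
  unfold instanceMean
  simp only [Set.mem_Icc]
  split_ifs
  · unfold baseMean
    split_ifs <;> constructor <;> linarith
  · by_cases hj : j = d
    · subst hj
      simp only [Function.update_self]
      constructor <;> linarith
    · simp only [Function.update_of_ne hj]
      unfold baseMean
      split_ifs <;> constructor <;> linarith

/-- Problem instance `d`, as a vector of success probabilities. -/
def problemInstance (k : ℕ) (d : Fin k) : Fin k → I :=
  fun j => ⟨instanceMean k d j, instanceMean_mem d j⟩

/-- Treatment `d` is the unique best treatment in problem instance `d`. -/
theorem problemInstance_lt {k : ℕ} (d j : Fin k) (hj : j ≠ d) :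
    problemInstance k d j < problemInstance k d d := by
  have h1 := shift_pos j
  have h3 := shift_pos d
  have hv : (j : ℕ) ≠ d := fun h => hj (Fin.ext h)
  rw [← Subtype.coe_lt_coe]
  simp only [problemInstance, instanceMean]
  split_ifs with h
  · have : (j : ℕ) ≠ 0 := fun h' => hv (h'.trans h.symm)
    simp only [baseMean, this, h, if_true, if_false]
    linarith
  · simp only [Function.update_self, Function.update_of_ne hj]
    unfold baseMean
    split_ifs <;> linarith

end PolicyChoice

end

open PolicyChoice

/-!
The exponent `GammaStar` of an instance is, up to a constant, the inverse of the sum of the inverse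
squared gaps (`le_GammaStar`). Raising treatment `d` to `1/2 + d / (4 k)` makes all gaps at least
of the order of `d / k`, and the gap of treatment `j` is of the order of `(d + j) / k`; so the
exponent of instance `d` is at least of the order of `d / k ^ 2` (`le_GammaStar_problemInstance`).

An algorithm cannot attain all these exponents, since it does not know which instance it faces.
To be good in the base instance it must usually implement treatment `1` there
(`Algorithm.regret_base_ge`). To tell instance `d` from the base instance it can only use the
outcomes of treatment `d`, each of which carries information of the order of `(d / k) ^ 2`. As
`∑ 1 / d` is of the order of `log k`, the `T` units of the base instance leave to some treatment
`d ≠ 1` an expected number of only about `T / (d log k)` units (`exists_expectedCount_le`), hence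
information of the order of `d T / (k ^ 2 log k)` about instance `d`. By a change of measure
(`Algorithm.policyLaw_change`), treatment `1` is then implemented in instance `d` with probability
at least `exp (-c d T / (k ^ 2 log k))`, up to a constant factor, which for large `T` exceeds
`exp (-800 GammaStar T / log k)`.

The change of measure needs finite sums only: with `L` the log-likelihood ratio of the record, the
probability of a policy in the other instance is an expectation of `exp (-L)`, and the tangent line
of the exponential bounds it from below through the expectation of `L`.
-/

noncomputable section

namespace PolicyChoice

/-! ### Expectations under laws on finite types -/

/-- Expectation of a real function under a probability mass function on a finite type, as a finite
sum. -/
def expect {α : Type*} [Fintype α] (p : PMF α) (f : α → ℝ) : ℝ :=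
  ∑ a, (p a).toReal * f a

section Expect

variable {α β : Type*} [Fintype α] [Fintype β]

theorem expect_pure (a : α) (f : α → ℝ) : expect (PMF.pure a) f = f a := by
  classical
  unfold expect
  rw [Finset.sum_eq_single a]
  · simp
  · intro b _ hb
    simp [PMF.pure_apply_of_ne _ _ hb]
  · simp

theorem expect_bind (p : PMF α) (q : α → PMF β) (f : β → ℝ) :
    expect (p.bind q) f = expect p fun a => expect (q a) f := by
  unfold expect
  have h : ∀ b, ((p.bind q) b).toReal = ∑ a, (p a).toReal * (q a b).toReal := by
    intro b
    rw [PMF.bind_apply, tsum_fintype, ENNReal.toReal_sum]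
    · simp
    · exact fun a _ => ENNReal.mul_ne_top (p.apply_ne_top a) ((q a).apply_ne_top b)
  simp only [h, Finset.sum_mul, Finset.mul_sum]
  rw [Finset.sum_comm]
  simp only [mul_assoc]

theorem expect_const (p : PMF α) (c : ℝ) : expect p (fun _ => c) = c := by
  have h : ∑ a, (p a).toReal = 1 := by
    rw [← ENNReal.toReal_sum fun a _ => p.apply_ne_top a, ← tsum_fintype (L := .unconditional _),
      p.tsum_coe]
    simp
  rw [expect, ← Finset.sum_mul, h, one_mul]

theorem expect_add (p : PMF α) (f g : α → ℝ) :
    expect p (fun a => f a + g a) = expect p f + expect p g := by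
  simp only [expect, mul_add, Finset.sum_add_distrib]

theorem expect_const_mul (p : PMF α) (c : ℝ) (f : α → ℝ) :
    expect p (fun a => c * f a) = c * expect p f := by
  simp only [expect, Finset.mul_sum]
  exact Finset.sum_congr rfl fun a _ => by ring

theorem expect_mul_const (p : PMF α) (f : α → ℝ) (c : ℝ) :
    expect p (fun a => f a * c) = expect p f * c := by
  simp only [mul_comm _ c, expect_const_mul]

theorem expect_mono (p : PMF α) {f g : α → ℝ} (h : ∀ a, f a ≤ g a) : expect p f ≤ expect p g :=
  Finset.sum_le_sum fun a _ => mul_le_mul_of_nonneg_left (h a) ENNReal.toReal_nonneg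

theorem expect_nonneg (p : PMF α) {f : α → ℝ} (h : ∀ a, 0 ≤ f a) : 0 ≤ expect p f :=
  Finset.sum_nonneg fun a _ => mul_nonneg ENNReal.toReal_nonneg (h a)

theorem expect_indicator [DecidableEq α] (p : PMF α) (a : α) :
    expect p (fun b => if b = a then 1 else 0) = (p a).toReal := by
  simp [expect]

theorem sum_toReal_eq_one (p : PMF α) : ∑ a, (p a).toReal = 1 := by
  simpa [expect] using expect_const p 1

theorem sum_expect {ι : Type*} (s : Finset ι) (p : PMF α) (f : ι → α → ℝ) :
    ∑ i ∈ s, expect p (f i) = expect p fun a => ∑ i ∈ s, f i a := by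
  simp only [expect, Finset.mul_sum]
  exact Finset.sum_comm

end Expect

/-- Mass function of a Bernoulli outcome with success probability `p`. -/
def outcomeMass (p : ℝ) (y : Bool) : ℝ := if y then p else 1 - p

theorem expect_outcomeLaw (p : I) (f : Bool → ℝ) :
    expect (outcomeLaw p) f = (p : ℝ) * f true + (1 - p) * f false := by
  have h : ∀ y, (outcomeLaw p y).toReal = outcomeMass p y := by
    intro y
    rw [outcomeLaw, MeasureTheory.Measure.toPMF_apply]
    change (ProbabilityTheory.bernoulliMeasure true false p).real {y} = _
    rw [ProbabilityTheory.bernoulliMeasure_real_apply _ (by measurability)]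
    cases y <;> simp [outcomeMass]
  simp [expect, h, outcomeMass]

/-! ### Change of measure between two vectors of means -/

/-- Log-likelihood ratio, of means `θ` against means `θ'`, of one observation. -/
def logRatio {k : ℕ} (θ θ' : Fin k → I) (z : Fin k × Bool) : ℝ :=
  Real.log (outcomeMass (θ z.1) z.2 / outcomeMass (θ' z.1) z.2)

/-- Log-likelihood ratio, of means `θ` against means `θ'`, of a record. The assignment
probabilities cancel, as the algorithm does not know the means. -/
def logLikelihood {k : ℕ} (θ θ' : Fin k → I) {t : ℕ} (h : History k t) : ℝ :=
  ∑ i, logRatio θ θ' (h i)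

theorem logLikelihood_snoc {k : ℕ} (θ θ' : Fin k → I) {t : ℕ} (h : History k t)
    (z : Fin k × Bool) :
    logLikelihood θ θ' (Fin.snoc h z : History k (t + 1)) =
      logLikelihood θ θ' h + logRatio θ θ' z := by
  simp [logLikelihood, Fin.sum_univ_castSucc]

theorem outcomeMass_pos {p : ℝ} (h0 : 0 < p) (h1 : p < 1) (y : Bool) : 0 < outcomeMass p y := by
  cases y <;> simp [outcomeMass, h0, h1]

theorem expect_logRatio {k : ℕ} (θ θ' : Fin k → I) (d : Fin k) :
    expect (outcomeLaw (θ d)) (fun y => logRatio θ θ' (d, y)) = dKL (θ d) (θ' d) := by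
  simp [expect_outcomeLaw, logRatio, outcomeMass, dKL]

namespace Algorithm

variable {k T : ℕ} (A : Algorithm k T)

theorem expect_historyLaw_succ (θ : Fin k → I) (t : ℕ) (F : History k (t + 1) → ℝ) :
    expect (A.historyLaw θ (t + 1)) F =
      expect (A.historyLaw θ t) fun h => expect (A.assign t h) fun d =>
        expect (outcomeLaw (θ d)) fun y => F (Fin.snoc h (d, y)) := by
  simp only [historyLaw, expect_bind, expect_pure]

/-- Expectations under the means `θ'` are expectations under `θ` weighted by the likelihood
ratio. -/
theorem expect_historyLaw_change {θ θ' : Fin k → I}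
    (h : ∀ d, (0 : ℝ) < θ d ∧ (θ d : ℝ) < 1) (h' : ∀ d, (0 : ℝ) < θ' d ∧ (θ' d : ℝ) < 1) (t : ℕ)
    (F : History k t → ℝ) :
    expect (A.historyLaw θ' t) F =
      expect (A.historyLaw θ t) fun g => F g * Real.exp (-logLikelihood θ θ' g) := by
  induction t with
  | zero => simp [historyLaw, expect_pure, logLikelihood]
  | succ t ih =>
    rw [expect_historyLaw_succ, expect_historyLaw_succ, ih]
    congr 1
    funext g
    rw [← expect_mul_const]
    congr 1
    funext d
    have key : ∀ y, outcomeMass (θ d) y * Real.exp (-logRatio θ θ' (d, y)) =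
        outcomeMass (θ' d) y := by
      intro y
      have h1 := outcomeMass_pos (h d).1 (h d).2 y
      have h2 := outcomeMass_pos (h' d).1 (h' d).2 y
      rw [logRatio, Real.exp_neg, Real.exp_log (div_pos h1 h2)]
      field_simp
    have kt := key true
    have kf := key false
    simp only [outcomeMass, if_true, Bool.false_eq_true, if_false] at kt kf
    simp only [expect_outcomeLaw, logLikelihood_snoc, neg_add, Real.exp_add]
    rw [← kf, ← kt]
    ring

/-- Expected number of the first `t` units that are assigned to treatment `d`. -/
def expectedCount (θ : Fin k → I) (t : ℕ) (d : Fin k) : ℝ :=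
  ∑ s ∈ Finset.range t, expect (A.historyLaw θ s) fun h => (A.assign s h d).toReal

theorem expectedCount_nonneg (θ : Fin k → I) (t : ℕ) (d : Fin k) :
    0 ≤ A.expectedCount θ t d :=
  Finset.sum_nonneg fun _ _ => expect_nonneg _ fun _ => ENNReal.toReal_nonneg

theorem sum_expectedCount (θ : Fin k → I) (t : ℕ) : ∑ d, A.expectedCount θ t d = t := by
  unfold expectedCount
  rw [Finset.sum_comm]
  simp [sum_expect, sum_toReal_eq_one, expect_const]

/-- The Kullback-Leibler divergence between the laws of the record is the sum over the treatments
of the expected number of assignments times the divergence of one outcome. -/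
theorem expect_logLikelihood (θ θ' : Fin k → I) (t : ℕ) :
    expect (A.historyLaw θ t) (logLikelihood θ θ') =
      ∑ d, A.expectedCount θ t d * dKL (θ d) (θ' d) := by
  induction t with
  | zero => simp [historyLaw, expect_pure, logLikelihood, expectedCount]
  | succ t ih =>
    rw [expect_historyLaw_succ]
    simp only [logLikelihood_snoc, expect_add, expect_const, expect_logRatio]
    rw [ih]
    simp only [expectedCount, Finset.sum_range_succ, add_mul, Finset.sum_add_distrib]
    congr 1
    simp only [← expect_mul_const, sum_expect]
    rfl

theorem policyLaw_toReal (θ : Fin k → I) (a : Fin k) :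
    (A.policyLaw θ a).toReal =
      expect (A.historyLaw θ T) fun h => (A.recommend h a).toReal := by
  simp only [← expect_indicator, policyLaw, expect_bind]

/-- If a policy has probability at least `1/2` under the means `θ`, then its probability under `θ'`
is at least `1/2 * exp (-2 * M)`, where `M` exceeds the divergence between the laws of the record
by at least `1`. -/
theorem policyLaw_change {θ θ' : Fin k → I}
    (h : ∀ d, (0 : ℝ) < θ d ∧ (θ d : ℝ) < 1) (h' : ∀ d, (0 : ℝ) < θ' d ∧ (θ' d : ℝ) < 1)
    {a : Fin k} (ha : 1 / 2 ≤ (A.policyLaw θ a).toReal) {M : ℝ} (hM0 : 0 ≤ M)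
    (hM : (∑ d, A.expectedCount θ T d * dKL (θ d) (θ' d)) + 1 ≤ M) :
    1 / 2 * Real.exp (-(2 * M)) ≤ (A.policyLaw θ' a).toReal := by
  set p := (A.policyLaw θ a).toReal
  rw [policyLaw_toReal, A.expect_historyLaw_change h h']
  set L : History k T → ℝ := logLikelihood θ θ'
  set w : History k T → ℝ := fun g => (A.recommend g a).toReal
  have hw0 : ∀ g, 0 ≤ w g := fun g => ENNReal.toReal_nonneg
  have hw1 : ∀ g, w g ≤ 1 := fun g =>
    ENNReal.toReal_le_of_le_ofReal zero_le_one (by simpa using (A.recommend g).coe_le_one a)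
  have hp : expect (A.historyLaw θ T) w = p := (A.policyLaw_toReal θ a).symm
  have hone : expect (A.historyLaw θ T) (fun g => Real.exp (-L g)) = 1 := by
    have := A.expect_historyLaw_change h h' T fun _ => 1
    simpa [expect_const] using this.symm
  -- Where the policy differs from `a`, the bound `-L ≤ exp (-L)` costs at most the total mass of
  -- the law of the record under `θ'`, that is, `1`.
  have hwL : expect (A.historyLaw θ T) (fun g => w g * L g) ≤ M := by
    have hle : expect (A.historyLaw θ T) (fun g => w g * L g) ≤
        expect (A.historyLaw θ T) (fun g => L g + Real.exp (-L g)) := by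
      refine expect_mono _ fun g => ?_
      have h1 : -L g ≤ Real.exp (-L g) := by linarith [Real.add_one_le_exp (-L g)]
      have h2 := Real.exp_pos (-L g)
      nlinarith [hw0 g, hw1 g, mul_le_mul_of_nonneg_left h1 (sub_nonneg.2 (hw1 g)),
        mul_nonneg (hw0 g) h2.le]
    rw [expect_add, hone] at hle
    have hL : expect (A.historyLaw θ T) L = _ := A.expect_logLikelihood θ θ' T
    linarith
  -- Tangent line of `exp` at `-2 * M`.
  have htan : expect (A.historyLaw θ T)
        (fun g => Real.exp (-(2 * M)) * ((1 + 2 * M) * w g + -1 * (w g * L g))) ≤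
      expect (A.historyLaw θ T) fun g => w g * Real.exp (-L g) := by
    refine expect_mono _ fun g => ?_
    have h1 : Real.exp (-(2 * M)) * (1 + 2 * M - L g) ≤ Real.exp (-L g) := by
      have h2 := Real.add_one_le_exp (2 * M - L g)
      have h3 : Real.exp (-L g) = Real.exp (-(2 * M)) * Real.exp (2 * M - L g) := by
        rw [← Real.exp_add]; congr 1; ring
      rw [h3]
      exact mul_le_mul_of_nonneg_left (by linarith) (Real.exp_pos _).le
    nlinarith [mul_le_mul_of_nonneg_left h1 (hw0 g)]
  rw [expect_const_mul, expect_add, expect_const_mul, expect_const_mul, hp] at htan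
  refine le_trans ?_ htan
  rw [mul_comm]
  refine mul_le_mul_of_nonneg_left ?_ (Real.exp_pos _).le
  nlinarith

end Algorithm

/-! ### Divergence of Bernoulli laws and the exponent -/

theorem dKL_self (p : ℝ) : dKL p p = 0 := by
  have h : ∀ x : ℝ, Real.log (x / x) = 0 := fun x => by
    rcases eq_or_ne x 0 with rfl | hx <;> simp [*]
  simp [dKL, h]

/-- A weak form of Pinsker's inequality, through the Hellinger distance. -/
theorem sq_sub_le_dKL {p q : ℝ} (hp0 : 0 < p) (hp1 : p < 1) (hq0 : 0 < q) (hq1 : q < 1) :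
    (p - q) ^ 2 ≤ dKL p q := by
  have key : ∀ u v : ℝ, 0 < u → 0 < v →
      2 * (u ^ 2 - u * v) ≤ u ^ 2 * Real.log (u ^ 2 / v ^ 2) := by
    intro u v hu hv
    have h1 := Real.log_le_sub_one_of_pos (div_pos hv hu)
    have h2 : Real.log (u ^ 2 / v ^ 2) = -(2 * Real.log (v / u)) := by
      rw [← div_pow, Real.log_pow, Real.log_div hu.ne' hv.ne', Real.log_div hv.ne' hu.ne']
      push_cast
      ring
    rw [h2]
    have h3 : u ^ 2 * (v / u - 1) = u * v - u ^ 2 := by field_simp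
    nlinarith [mul_le_mul_of_nonneg_left h1 (sq_nonneg u)]
  obtain ⟨a, ha, rfl⟩ : ∃ a, 0 < a ∧ p = a ^ 2 := ⟨√p, by positivity, (Real.sq_sqrt hp0.le).symm⟩
  obtain ⟨b, hb, rfl⟩ : ∃ b, 0 < b ∧ q = b ^ 2 := ⟨√q, by positivity, (Real.sq_sqrt hq0.le).symm⟩
  obtain ⟨c, hc, hac⟩ : ∃ c, 0 < c ∧ 1 - a ^ 2 = c ^ 2 :=
    ⟨√(1 - a ^ 2), Real.sqrt_pos.2 (by linarith), (Real.sq_sqrt (by linarith)).symm⟩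
  obtain ⟨d, hd, hbd⟩ : ∃ d, 0 < d ∧ 1 - b ^ 2 = d ^ 2 :=
    ⟨√(1 - b ^ 2), Real.sqrt_pos.2 (by linarith), (Real.sq_sqrt (by linarith)).symm⟩
  have h1 := key a b ha hb
  have h2 := key c d hc hd
  rw [dKL, hac, hbd]
  -- `(a * b + c * d) ^ 2 + (a * d - b * c) ^ 2 = 1` on the unit circle.
  have e1 : (a * b + c * d) ^ 2 + (a * d - b * c) ^ 2 = 1 := by
    have : (a * b + c * d) ^ 2 + (a * d - b * c) ^ 2 = (a ^ 2 + c ^ 2) * (b ^ 2 + d ^ 2) := by ring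
    rw [this, ← hac, ← hbd]; ring
  have e2 : a ^ 2 - b ^ 2 = (a * d - b * c) * (a * d + b * c) := by
    have : (a * d - b * c) * (a * d + b * c) = a ^ 2 * d ^ 2 - b ^ 2 * c ^ 2 := by ring
    rw [this, ← hac, ← hbd]; ring
  have e3 : (a * d + b * c) ^ 2 ≤ 1 := by
    have : (a * d + b * c) ^ 2 + (a * b - c * d) ^ 2 = (a ^ 2 + c ^ 2) * (b ^ 2 + d ^ 2) := by ring
    rw [← hac, ← hbd] at this
    nlinarith [sq_nonneg (a * b - c * d)]
  have e4 : (a ^ 2 - b ^ 2) ^ 2 ≤ (a * d - b * c) ^ 2 := by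
    rw [e2, mul_pow]
    nlinarith [sq_nonneg (a * d - b * c)]
  nlinarith [sq_nonneg (a * b + c * d - 1)]

theorem dKL_half_sub_half_add_le {f : ℝ} (h0 : 0 ≤ f) (h1 : f ≤ 1 / 4) :
    dKL (1 / 2 - f) (1 / 2 + f) ≤ 16 * f ^ 2 := by
  have hs : dKL (1 / 2 - f) (1 / 2 + f) = 2 * f * Real.log ((1 / 2 + f) / (1 / 2 - f)) := by
    have ha : (1 / 2 + f) ≠ 0 := by linarith
    have hb : (1 / 2 - f) ≠ 0 := by linarith
    rw [dKL, show 1 - (1 / 2 - f) = 1 / 2 + f by ring, show 1 - (1 / 2 + f) = 1 / 2 - f by ring,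
      Real.log_div ha hb, Real.log_div hb ha]
    ring
  have hpos : (0 : ℝ) < 1 / 2 - f := by linarith
  have hl := Real.log_le_sub_one_of_pos (div_pos (by linarith : (0 : ℝ) < 1 / 2 + f) hpos)
  have hl' : (1 / 2 + f) / (1 / 2 - f) - 1 ≤ 8 * f := by
    rw [sub_le_iff_le_add, div_le_iff₀ hpos]
    nlinarith
  rw [hs]
  nlinarith

section Exponent

variable {k : ℕ} {θ : Fin k → I} {b : Fin k}

/-- Two quadratics with weights `1/2` and `r ≤ 1/2`, centred at the two means, are jointly at least
half of `r` times the squared gap. -/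
theorem le_rateG {ρ : Fin k → ℝ} {j : Fin k} (hj : θ j < θ b) (h0 : (0 : ℝ) < θ j)
    (h1 : (θ b : ℝ) < 1) (hb : ρ b = 1 / 2) (hr0 : 0 ≤ ρ j) (hr1 : ρ j ≤ 1 / 2) :
    ρ j / 2 * ((θ b : ℝ) - θ j) ^ 2 ≤ rateG θ b ρ j := by
  have hj' : (θ j : ℝ) < θ b := hj
  refine le_csInf ((Set.nonempty_Icc.2 hj'.le).image _) ?_
  rintro _ ⟨x, ⟨hx1, hx2⟩, rfl⟩
  have hb' := sq_sub_le_dKL (p := x) (q := θ b) (by linarith) (by linarith) (by linarith) h1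
  have hjj := sq_sub_le_dKL (p := x) (q := θ j) (by linarith) (by linarith) h0 (by linarith)
  have e1 := mul_le_mul_of_nonneg_left hjj hr0
  have e2 : ρ j * (x - θ b) ^ 2 ≤ 1 / 2 * (x - θ b) ^ 2 :=
    mul_le_mul_of_nonneg_right hr1 (sq_nonneg _)
  have e3 : (0 : ℝ) ≤ ρ j * ((x - θ b) + (x - θ j)) ^ 2 := by positivity
  simp only [hb]
  nlinarith

theorem rateG_le {ρ : Fin k → ℝ} {j : Fin k} (hj : θ j < θ b) (h0 : (0 : ℝ) < θ j)
    (h1 : (θ b : ℝ) < 1) (hb : 0 ≤ ρ b) (hr0 : 0 ≤ ρ j) :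
    rateG θ b ρ j ≤ ρ b * dKL (θ j) (θ b) := by
  have hj' : (θ j : ℝ) < θ b := hj
  have hbdd : BddBelow ((fun x : ℝ => ρ b * dKL x (θ b) + ρ j * dKL x (θ j)) ''
      Set.Icc (θ j : ℝ) (θ b : ℝ)) := by
    refine ⟨0, ?_⟩
    rintro _ ⟨x, ⟨hx1, hx2⟩, rfl⟩
    have hb' := sq_sub_le_dKL (p := x) (q := θ b) (by linarith) (by linarith) (by linarith) h1
    have hjj := sq_sub_le_dKL (p := x) (q := θ j) (by linarith) (by linarith) h0 (by linarith)
    exact add_nonneg (mul_nonneg hb ((sq_nonneg _).trans hb'))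
      (mul_nonneg hr0 ((sq_nonneg _).trans hjj))
  have := csInf_le hbdd ⟨(θ j : ℝ), Set.left_mem_Icc.2 hj'.le, rfl⟩
  simpa [dKL_self, rateG] using this

/-- The exponent is at least of the order of the inverse of the sum of the inverse squared gaps, as
assignment shares inversely proportional to the squared gaps show. -/
theorem le_GammaStar (hθ : ∀ j, j ≠ b → θ j < θ b) (h0 : ∀ j, (0 : ℝ) < θ j)
    (h1 : (θ b : ℝ) < 1) {j₀ : Fin k} (hj₀ : j₀ ≠ b) :
    1 / (4 * ∑ j ∈ Finset.univ.erase b, 1 / ((θ b : ℝ) - θ j) ^ 2) ≤ GammaStar θ b := by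
  set w : Fin k → ℝ := fun j => 1 / ((θ b : ℝ) - θ j) ^ 2
  set W : ℝ := ∑ j ∈ Finset.univ.erase b, w j
  have hgap : ∀ j, j ≠ b → (0 : ℝ) < (θ b : ℝ) - θ j := fun j hj => sub_pos.2 (hθ j hj)
  have hw : ∀ j, 0 ≤ w j := fun j => by positivity
  have hwW : ∀ j, j ≠ b → w j ≤ W := fun j hj =>
    Finset.single_le_sum (f := w) (fun i _ => hw i) (by simp [hj])
  have hW : 0 < W :=
    lt_of_lt_of_le (one_div_pos.2 (pow_pos (hgap j₀ hj₀) 2)) (hwW j₀ hj₀)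
  refine le_csSup ⟨1 / 2 * dKL (θ j₀) (θ b), ?_⟩ ?_
  · rintro Γ ⟨ρ, hρ, -, hρb, hΓ⟩
    rw [← hρb]
    exact (hΓ j₀ hj₀).trans (rateG_le (hθ j₀ hj₀) (h0 j₀) h1 (hρ b) (hρ j₀))
  · refine ⟨fun j => if j = b then 1 / 2 else w j / (2 * W), fun j => ?_, ?_, by simp,
      fun j hj => ?_⟩
    · have := hw j
      dsimp only
      split_ifs <;> positivity
    · rw [← Finset.add_sum_erase _ _ (Finset.mem_univ b), if_pos rfl,
        Finset.sum_congr rfl fun j hj => if_neg (Finset.ne_of_mem_erase hj), ← Finset.sum_div]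
      change 1 / 2 + W / (2 * W) = 1
      field_simp
      norm_num
    · refine le_trans (le_of_eq ?_) (le_rateG (hθ j hj) (h0 j) h1 (by simp) ?_ ?_)
      · have := (hgap j hj).ne'
        simp only [hj, if_false, w]
        field_simp
        norm_num
      · have := hw j
        simp only [hj, if_false]
        positivity
      · simp only [hj, if_false]
        rw [div_le_iff₀ (by positivity)]
        linarith [hwW j hj]

end Exponent

/-! ### The problem instances -/

section Instances

variable {k : ℕ}

theorem instanceMean_pos (d j : Fin k) : 0 < instanceMean k d j := by
  have h1 := shift_le j
  have h2 := shift_pos d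
  unfold instanceMean
  split_ifs
  · unfold baseMean
    split_ifs <;> linarith
  · by_cases hj : j = d
    · subst hj
      simp only [Function.update_self]
      linarith
    · simp only [Function.update_of_ne hj]
      unfold baseMean
      split_ifs <;> linarith

theorem instanceMean_lt_one (d j : Fin k) : instanceMean k d j < 1 := by
  have h1 := shift_pos j
  have h2 := shift_le d
  unfold instanceMean
  split_ifs
  · unfold baseMean
    split_ifs <;> linarith
  · by_cases hj : j = d
    · subst hj
      simp only [Function.update_self]
      linarith
    · simp only [Function.update_of_ne hj]
      unfold baseMean
      split_ifs <;> linarith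

theorem problemInstance_mem_Ioo (d j : Fin k) :
    (0 : ℝ) < problemInstance k d j ∧ (problemInstance k d j : ℝ) < 1 :=
  ⟨instanceMean_pos d j, instanceMean_lt_one d j⟩

theorem iSup_problemInstance (d : Fin k) :
    ⨆ j, (problemInstance k d j : ℝ) = problemInstance k d d := by
  have : Nonempty (Fin k) := ⟨d⟩
  refine le_antisymm (ciSup_le fun j => ?_)
    (le_ciSup (f := fun j => (problemInstance k d j : ℝ)) (Set.finite_range _).bddAbove d)
  by_cases hj : j = d
  · rw [hj]
  · exact (problemInstance_lt d j hj).le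

/-- The gap between the best treatment `d` of a raised instance and treatment `j`. -/
theorem problemInstance_gap {d j : Fin k} (hd : (d : ℕ) ≠ 0) (hj : j ≠ d) :
    (problemInstance k d d : ℝ) - problemInstance k d j =
      shift k d + if (j : ℕ) = 0 then 0 else shift k j := by
  simp only [problemInstance, instanceMean, hd, if_false, Function.update_self,
    Function.update_of_ne hj, baseMean]
  split_ifs <;> ring

theorem problemInstance_base_gap {z j : Fin k} (hz : (z : ℕ) = 0) (hj : j ≠ z) :
    (problemInstance k z z : ℝ) - problemInstance k z j = shift k j := by
  have hj' : (j : ℕ) ≠ 0 := fun h => hj (Fin.ext (h.trans hz.symm))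
  simp [problemInstance, instanceMean, baseMean, hz, hj']

theorem problemInstance_gap_pos {d j : Fin k} (hj : j ≠ d) :
    0 < (problemInstance k d d : ℝ) - problemInstance k d j :=
  sub_pos.2 (problemInstance_lt d j hj)

theorem problemInstance_gap_nonneg (d j : Fin k) :
    0 ≤ (problemInstance k d d : ℝ) - problemInstance k d j := by
  by_cases hj : j = d
  · rw [hj, sub_self]
  · exact (problemInstance_gap_pos hj).le

theorem GammaStar_pos (hk : 2 ≤ k) (d : Fin k) : 0 < GammaStar (problemInstance k d) d := by
  have : Nontrivial (Fin k) := Fin.nontrivial_iff_two_le.2 hk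
  obtain ⟨j, hj⟩ := exists_ne d
  refine lt_of_lt_of_le ?_ (le_GammaStar (problemInstance_lt d)
    (fun j => (problemInstance_mem_Ioo d j).1) (problemInstance_mem_Ioo d d).2 hj)
  have : 0 < ∑ j ∈ Finset.univ.erase d,
      1 / ((problemInstance k d d : ℝ) - problemInstance k d j) ^ 2 :=
    Finset.sum_pos (fun i hi => one_div_pos.2 (pow_pos (problemInstance_gap_pos
      (Finset.ne_of_mem_erase hi)) 2)) ⟨j, by simp [hj]⟩
  positivity

/-- In the instance that raises treatment `d`, the sum of the inverse squared gaps is of the order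
`k ^ 2 / d`: all gaps are at least of the order of `d / k`, and they grow linearly. -/
theorem sum_inv_sq_gap_le {d : Fin k} (hd : (d : ℕ) ≠ 0) :
    ∑ j ∈ Finset.univ.erase d,
      1 / ((problemInstance k d d : ℝ) - problemInstance k d j) ^ 2 ≤
        24 * (k : ℝ) ^ 2 / ((d : ℝ) + 1) := by
  have hk : (0 : ℝ) < k := by exact_mod_cast d.pos
  have hD : (2 : ℝ) ≤ (d : ℝ) + 1 := by
    have : (1 : ℝ) ≤ (d : ℕ) := by exact_mod_cast Nat.one_le_iff_ne_zero.2 hd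
    linarith
  set D : ℝ := (d : ℝ) + 1 with hDdef
  -- `g n` bounds the term of treatment `n`. Up to a correction at `n = 0`, whose gap lacks the
  -- shift of the treatment itself, these bounds telescope.
  let g : ℕ → ℝ := fun n =>
    16 * k ^ 2 * ((if n = 0 then 1 / D ^ 2 else 0) + (1 / (D + n) - 1 / (D + n + 1)))
  have hDn : ∀ n : ℕ, 0 < D + n := fun n => by positivity
  have hg0 : ∀ n, 0 ≤ g n := fun n => by
    have h1 : 1 / (D + n + 1) ≤ 1 / (D + n) := one_div_le_one_div_of_le (hDn n) (by linarith)
    have h2 : (0 : ℝ) ≤ if n = 0 then 1 / D ^ 2 else 0 := by split_ifs <;> positivity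
    exact mul_nonneg (by positivity) (by linarith)
  have hsum : ∀ n : ℕ, ∑ i ∈ Finset.range n, g i ≤
      16 * k ^ 2 * (1 / D ^ 2 + (1 / D - 1 / (D + n))) := by
    intro n
    induction n with
    | zero => simp only [Finset.range_zero, Finset.sum_empty]; push_cast; simp; positivity
    | succ n ih =>
      rcases n with _ | n
      · simp [g]
      · rw [Finset.sum_range_succ]
        refine (add_le_add_left ih _).trans (le_of_eq ?_)
        simp only [g, Nat.add_eq_zero_iff, one_ne_zero, and_false, if_false]
        push_cast
        ring
  have hterm : ∀ j ∈ Finset.univ.erase d,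
      1 / ((problemInstance k d d : ℝ) - problemInstance k d j) ^ 2 ≤ g j := by
    intro j hj
    rw [problemInstance_gap hd (Finset.ne_of_mem_erase hj)]
    have hjn := hDn j
    split_ifs with h0
    · simp only [g, h0, if_true, shift, Nat.cast_zero, add_zero]
      have h1 : 1 / (D + 1) ≤ 1 / D := one_div_le_one_div_of_le (by linarith) (by linarith)
      have h2 : 1 / (((d : ℝ) + 1) / (4 * k)) ^ 2 = 16 * k ^ 2 * (1 / D ^ 2) := by
        rw [← hDdef]
        field_simp
        norm_num
      rw [h2]
      exact mul_le_mul_of_nonneg_left (by linarith) (by positivity)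
    · simp only [g, h0, if_false, shift, zero_add]
      have h2 : 1 / (((d : ℝ) + 1) / (4 * k) + ((j : ℝ) + 1) / (4 * k)) ^ 2 =
          16 * k ^ 2 * (1 / (D + j + 1) ^ 2) := by
        rw [← hDdef, ← add_div, ← add_assoc]
        field_simp
        norm_num
      rw [h2]
      refine mul_le_mul_of_nonneg_left ?_ (by positivity)
      have h3 : 1 / (D + j) - 1 / (D + j + 1) = 1 / ((D + j) * (D + j + 1)) := by
        field_simp
        ring
      rw [h3]
      exact one_div_le_one_div_of_le (by positivity) (by nlinarith)
  calc _ ≤ ∑ j ∈ Finset.univ.erase d, g j := Finset.sum_le_sum hterm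
    _ ≤ ∑ j : Fin k, g j :=
      Finset.sum_le_sum_of_subset_of_nonneg (Finset.erase_subset _ _) fun j _ _ => hg0 j
    _ = ∑ i ∈ Finset.range k, g i := Fin.sum_univ_eq_sum_range g k
    _ ≤ 16 * k ^ 2 * (1 / D ^ 2 + (1 / D - 1 / (D + k))) := hsum k
    _ ≤ 16 * k ^ 2 * (1 / (2 * D) + 1 / D) := by
      have h1 : 1 / D ^ 2 ≤ 1 / (2 * D) := one_div_le_one_div_of_le (by positivity) (by nlinarith)
      have h2 : 0 ≤ 1 / (D + k) := by positivity
      exact mul_le_mul_of_nonneg_left (by linarith) (by positivity)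
    _ = 24 * (k : ℝ) ^ 2 / D := by
      field_simp
      norm_num

theorem le_GammaStar_problemInstance {d : Fin k} (hd : (d : ℕ) ≠ 0) :
    ((d : ℝ) + 1) / (96 * k ^ 2) ≤ GammaStar (problemInstance k d) d := by
  have hk : (0 : ℝ) < k := by exact_mod_cast d.pos
  have hz : (⟨0, d.pos⟩ : Fin k) ≠ d := fun h => hd (by rw [← h])
  refine le_trans ?_ (le_GammaStar (problemInstance_lt d)
    (fun j => (problemInstance_mem_Ioo d j).1) (problemInstance_mem_Ioo d d).2 hz)
  have hpos : 0 < ∑ j ∈ Finset.univ.erase d,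
      1 / ((problemInstance k d d : ℝ) - problemInstance k d j) ^ 2 :=
    Finset.sum_pos (fun i hi => one_div_pos.2 (pow_pos (problemInstance_gap_pos
      (Finset.ne_of_mem_erase hi)) 2)) ⟨_, by simpa using hz⟩
  have h := sum_inv_sq_gap_le hd
  rw [le_div_iff₀ (by positivity)] at h
  rw [div_le_div_iff₀ (by positivity) (by positivity)]
  linarith

theorem log_div_two_le_sum (hk : 1 ≤ k) :
    Real.log k / 2 ≤ ∑ d : Fin k, if (d : ℕ) = 0 then (0 : ℝ) else 1 / ((d : ℝ) + 1) := by
  rw [Fin.sum_univ_eq_sum_range (fun n : ℕ => if n = 0 then (0 : ℝ) else 1 / ((n : ℝ) + 1)) k]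
  induction k, hk using Nat.le_induction with
  | base => simp
  | succ n hn ih =>
    have hn' : (1 : ℝ) ≤ n := by exact_mod_cast hn
    rw [Finset.sum_range_succ, if_neg (by omega)]
    have h1 := Real.log_le_sub_one_of_pos (x := ((n : ℝ) + 1) / n) (by positivity)
    rw [Real.log_div (by positivity) (by positivity)] at h1
    have h2 : ((n : ℝ) + 1) / n - 1 ≤ 2 * (1 / (n + 1)) := by
      have : ((n : ℝ) + 1) / n - 1 = 1 / n := by field_simp; ring
      rw [this, mul_one_div, div_le_div_iff₀ (by positivity) (by positivity)]
      linarith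
    push_cast
    linarith

/-- The base instance and the one that raises treatment `d` differ in the mean of `d` only. -/
theorem sum_expectedCount_mul_dKL_le {T : ℕ} (A : Algorithm k T) {z d : Fin k} (hz : (z : ℕ) = 0)
    (hd : (d : ℕ) ≠ 0) :
    ∑ j, A.expectedCount (problemInstance k z) T j *
        dKL (problemInstance k z j) (problemInstance k d j) ≤
      A.expectedCount (problemInstance k z) T d * (16 * shift k d ^ 2) := by
  rw [Finset.sum_eq_single d]
  · refine mul_le_mul_of_nonneg_left ?_ (A.expectedCount_nonneg _ _ _)
    have := dKL_half_sub_half_add_le (shift_pos d).le (shift_le d)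
    simpa [problemInstance, instanceMean, baseMean, hz, hd] using this
  · intro j _ hj
    have : problemInstance k d j = problemInstance k z j := by
      simp [problemInstance, instanceMean, hz, hd, Function.update_of_ne hj]
    rw [this, dKL_self, mul_zero]
  · simp

/-- Under any means, some treatment `d` other than the first gets at most a share of the order of
`1 / (d * log k)` of the units: all these shares being larger, their sum would exceed `1`. -/
theorem exists_expectedCount_le (hk : 2 ≤ k) {T : ℕ} (A : Algorithm k T) (θ : Fin k → I) :
    ∃ d : Fin k, (d : ℕ) ≠ 0 ∧
      A.expectedCount θ T d ≤ 2 * T / Real.log k * (1 / ((d : ℝ) + 1)) := by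
  have hlog : 0 < Real.log k := Real.log_pos (by exact_mod_cast hk)
  by_contra! hcon
  set c : ℝ := 2 * T / Real.log k
  have hc : 0 ≤ c := by positivity
  have hlt : ∑ d : Fin k, c * (if (d : ℕ) = 0 then (0 : ℝ) else 1 / ((d : ℝ) + 1)) <
      ∑ d, A.expectedCount θ T d := by
    refine Finset.sum_lt_sum (fun d _ => ?_) ⟨⟨1, hk⟩, Finset.mem_univ _, ?_⟩
    · split_ifs with h
      · rw [mul_zero]; exact A.expectedCount_nonneg θ T d
      · exact (hcon d h).le
    · simpa using hcon ⟨1, hk⟩ (by simp)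
  rw [A.sum_expectedCount, ← Finset.mul_sum] at hlt
  have h1 := mul_le_mul_of_nonneg_left (log_div_two_le_sum (by omega : 1 ≤ k)) hc
  have h2 : c * (Real.log k / 2) = T := by
    simp only [c]
    field_simp
  linarith

end Instances

/-! ### The lower bound -/

namespace Algorithm

variable {k T : ℕ} (A : Algorithm k T)

theorem gap_mul_policyLaw_le_regret (d j : Fin k) :
    ((problemInstance k d d : ℝ) - problemInstance k d j) *
      (A.policyLaw (problemInstance k d) j).toReal ≤ A.regret (problemInstance k d) := by
  rw [regret, iSup_problemInstance]
  exact Finset.single_le_sum (f := fun j => ((problemInstance k d d : ℝ) - problemInstance k d j) *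
      (A.policyLaw (problemInstance k d) j).toReal)
    (fun i _ => mul_nonneg (problemInstance_gap_nonneg d i) ENNReal.toReal_nonneg)
    (Finset.mem_univ j)

theorem regret_base_ge {z : Fin k} (hz : (z : ℕ) = 0)
    (h : (A.policyLaw (problemInstance k z) z).toReal < 1 / 2) :
    1 / (8 * (k : ℝ)) ≤ A.regret (problemInstance k z) := by
  have hk : (0 : ℝ) < k := by exact_mod_cast z.pos
  rw [regret, iSup_problemInstance]
  have hsum := sum_toReal_eq_one (A.policyLaw (problemInstance k z))
  rw [← Finset.add_sum_erase _ _ (Finset.mem_univ z)] at hsum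
  rw [← Finset.add_sum_erase _ _ (Finset.mem_univ z), sub_self, zero_mul, zero_add]
  have hle : ∑ j ∈ Finset.univ.erase z,
        1 / (4 * (k : ℝ)) * (A.policyLaw (problemInstance k z) j).toReal ≤
      ∑ j ∈ Finset.univ.erase z, ((problemInstance k z z : ℝ) - problemInstance k z j) *
        (A.policyLaw (problemInstance k z) j).toReal := by
    refine Finset.sum_le_sum fun j hj => mul_le_mul_of_nonneg_right ?_ ENNReal.toReal_nonneg
    rw [problemInstance_base_gap hz (Finset.ne_of_mem_erase hj), shift]
    exact div_le_div_of_nonneg_right (by linarith [Nat.cast_nonneg (α := ℝ) (j : ℕ)])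
      (by positivity)
  rw [← Finset.mul_sum] at hle
  refine le_trans ?_ hle
  have h3 : 1 / (8 * (k : ℝ)) = 1 / (4 * k) * (1 / 2) := by field_simp; norm_num
  rw [h3]
  exact mul_le_mul_of_nonneg_left (by linarith) (by positivity)

/-- Either the algorithm often errs in the base instance, or it errs with a probability that
decays slowly in one of the other instances. -/
theorem exists_regret_ge (hk : 2 ≤ k) {z : Fin k} (hz : (z : ℕ) = 0) :
    1 / (8 * (k : ℝ)) ≤ A.regret (problemInstance k z) ∨
      ∃ d : Fin k, (d : ℕ) ≠ 0 ∧
        shift k d * (1 / 2 * Real.exp (-2)) *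
            Real.exp (-(4 * ((d : ℝ) + 1) / (k ^ 2 * Real.log k) * T)) ≤
          A.regret (problemInstance k d) := by
  rcases lt_or_ge (A.policyLaw (problemInstance k z) z).toReal (1 / 2) with h | h
  · exact Or.inl (A.regret_base_ge hz h)
  refine Or.inr ?_
  obtain ⟨d, hd, hcount⟩ := exists_expectedCount_le hk A (problemInstance k z)
  refine ⟨d, hd, ?_⟩
  have hk0 : (0 : ℝ) < k := by exact_mod_cast d.pos
  have hlog : 0 < Real.log k := Real.log_pos (by exact_mod_cast hk)
  set M : ℝ := 2 * ((d : ℝ) + 1) / (k ^ 2 * Real.log k) * T + 1 with hMdef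
  have hM : (∑ j, A.expectedCount (problemInstance k z) T j *
      dKL (problemInstance k z j) (problemInstance k d j)) + 1 ≤ M := by
    have h1 := sum_expectedCount_mul_dKL_le A hz hd
    have h2 := mul_le_mul_of_nonneg_right hcount
      (by positivity : (0 : ℝ) ≤ 16 * shift k d ^ 2)
    have h3 : 2 * T / Real.log k * (1 / ((d : ℝ) + 1)) * (16 * shift k d ^ 2) =
        2 * ((d : ℝ) + 1) / (k ^ 2 * Real.log k) * T := by
      rw [shift]
      field_simp
      norm_num
    linarith
  have hq := A.policyLaw_change (problemInstance_mem_Ioo z) (problemInstance_mem_Ioo d) h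
    (by positivity) hM
  have hzd : z ≠ d := fun e => hd (e ▸ hz)
  have hr := A.gap_mul_policyLaw_le_regret d z
  rw [problemInstance_gap hd hzd, if_pos hz, add_zero] at hr
  refine le_trans (le_of_eq ?_) ((mul_le_mul_of_nonneg_left hq (shift_pos d).le).trans hr)
  have : -(2 * M) = -2 + -(4 * ((d : ℝ) + 1) / (k ^ 2 * Real.log k) * T) := by
    rw [hMdef]; ring
  rw [this, Real.exp_add]
  ring

end Algorithm

theorem eventually_exp_le_const_mul_exp {a b c : ℝ} (hc : 0 < c) (hab : a < b) :
    ∀ᶠ T : ℕ in Filter.atTop, Real.exp (-(b * T)) ≤ c * Real.exp (-(a * T)) := by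
  have h : Filter.Tendsto (fun T : ℕ => Real.exp (-((b - a) * T))) Filter.atTop (nhds 0) :=
    Real.tendsto_exp_neg_atTop_nhds_zero.comp
      (tendsto_natCast_atTop_atTop.const_mul_atTop (sub_pos.2 hab))
  filter_upwards [h.eventually_le_const hc] with T hT
  have : Real.exp (-(b * T)) = Real.exp (-((b - a) * T)) * Real.exp (-(a * T)) := by
    rw [← Real.exp_add]; congr 1; ring
  rw [this]
  exact mul_le_mul_of_nonneg_right hT (Real.exp_pos _).le

theorem eventually_exists_exp_le_regret {k : ℕ} (hk : 2 ≤ k) :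
    ∀ᶠ T : ℕ in Filter.atTop, ∀ A : Algorithm k T, ∃ d : Fin k,
      Real.exp (-(800 / Real.log k * GammaStar (problemInstance k d) d * T)) ≤
        A.regret (problemInstance k d) := by
  have hk0 : (0 : ℝ) < k := by positivity
  have hlog : 0 < Real.log k := Real.log_pos (by exact_mod_cast hk)
  let z : Fin k := ⟨0, by omega⟩
  have hbase : ∀ᶠ T : ℕ in Filter.atTop,
      Real.exp (-(800 / Real.log k * GammaStar (problemInstance k z) z * T)) ≤
        1 / (8 * (k : ℝ)) := by
    have := GammaStar_pos hk z
    have hpos : 0 < 800 / Real.log k * GammaStar (problemInstance k z) z := by positivity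
    simpa using eventually_exp_le_const_mul_exp (c := 1 / (8 * (k : ℝ))) (by positivity) hpos
  have hrest : ∀ᶠ T : ℕ in Filter.atTop, ∀ d : Fin k, (d : ℕ) ≠ 0 →
      Real.exp (-(800 / Real.log k * GammaStar (problemInstance k d) d * T)) ≤
        shift k d * (1 / 2 * Real.exp (-2)) *
          Real.exp (-(4 * ((d : ℝ) + 1) / (k ^ 2 * Real.log k) * T)) := by
    refine Filter.eventually_all.2 fun d => ?_
    by_cases hd : (d : ℕ) = 0
    · simp [hd]
    have hs := shift_pos d
    refine (eventually_exp_le_const_mul_exp (by positivity) ?_).mono fun T hT _ => hT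
    have h1 := le_GammaStar_problemInstance hd
    have h2 : 4 * ((d : ℝ) + 1) / (k ^ 2 * Real.log k) =
        384 / Real.log k * (((d : ℝ) + 1) / (96 * k ^ 2)) := by
      field_simp
      norm_num
    have h3 : (0 : ℝ) < ((d : ℝ) + 1) / (96 * k ^ 2) := by positivity
    rw [h2]
    refine lt_of_lt_of_le (mul_lt_mul_of_pos_right ?_ h3)
      (mul_le_mul_of_nonneg_left h1 (by positivity))
    exact div_lt_div_of_pos_right (by norm_num) hlog
  filter_upwards [hbase, hrest] with T hT₁ hT₂ A
  rcases A.exists_regret_ge hk (z := z) rfl with h | ⟨d, hd, h⟩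
  · exact ⟨z, hT₁.trans h⟩
  · exact ⟨d, (hT₂ d hd).trans h⟩

theorem neg_log_div_le_of_exp_le {T : ℕ} (hT : 0 < T) {a r : ℝ} (h : Real.exp (-(a * T)) ≤ r) :
    -(1 / (T : ℝ)) * Real.log r ≤ a := by
  have hT' : (0 : ℝ) < T := by exact_mod_cast hT
  have h1 := (Real.le_log_iff_exp_le ((Real.exp_pos _).trans_le h)).2 h
  have h2 : -(1 / (T : ℝ)) * Real.log r = -Real.log r / T := by ring
  rw [h2, div_le_iff₀ hT']
  linarith

end PolicyChoice

end

theorem mainTheorem1 (k : ℕ) (hk : 2 ≤ k) :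
    (∃ T₀ : ℕ, ∀ T : ℕ, T₀ < T → ∀ A : Algorithm k T, ∃ d : Fin k,
      Real.exp (-(800 / Real.log k * GammaStar (problemInstance k d) d * T))
          ≤ A.regret (problemInstance k d) ∧
        -(1 / (T : ℝ)) * Real.log (A.regret (problemInstance k d))
          ≤ 800 / Real.log k * GammaStar (problemInstance k d) d) ∧
    (∀ A : (T : ℕ) → Algorithm k T, ∃ d : Fin k, ∃ᶠ T : ℕ in Filter.atTop,
      Real.exp (-(800 / Real.log k * GammaStar (problemInstance k d) d * T))
        ≤ (A T).regret (problemInstance k d)) ∧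
    (800 < Real.log k → ∀ A : (T : ℕ) → Algorithm k T,
      ¬ ∀ d : Fin k, Filter.Tendsto
        (fun T : ℕ => -(1 / (T : ℝ)) * Real.log ((A T).regret (problemInstance k d)))
        Filter.atTop (nhds (GammaStar (problemInstance k d) d))) := by
  have hev := eventually_exists_exp_le_regret hk
  have hfreq : ∀ A : (T : ℕ) → Algorithm k T, ∃ d : Fin k, ∃ᶠ T : ℕ in Filter.atTop,
      Real.exp (-(800 / Real.log k * GammaStar (problemInstance k d) d * T))
        ≤ (A T).regret (problemInstance k d) := by
    intro A
    by_contra! hcon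
    obtain ⟨T, h1, h2⟩ := (hev.and (Filter.eventually_all.2 hcon)).exists
    obtain ⟨d, hd⟩ := h1 (A T)
    exact (h2 d).not_ge hd
  refine ⟨?_, hfreq, ?_⟩
  · obtain ⟨T₀, hT₀⟩ := Filter.eventually_atTop.1 hev
    refine ⟨T₀, fun T hT A => ?_⟩
    obtain ⟨d, hd⟩ := hT₀ T hT.le A
    exact ⟨d, hd, neg_log_div_le_of_exp_le (by omega) hd⟩
  · intro hlog A hlim
    obtain ⟨d, hd⟩ := hfreq A
    have hΓ := GammaStar_pos hk d
    have hle : GammaStar (problemInstance k d) d ≤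
        800 / Real.log k * GammaStar (problemInstance k d) d :=
      le_of_tendsto_of_frequently (hlim d) ((hd.and_eventually (Filter.eventually_gt_atTop 0)).mono
        fun T hT => neg_log_div_le_of_exp_le hT.2 hT.1)
    have h1 : 800 / Real.log k < 1 := (div_lt_one (by linarith)).2 hlog
    nlinarith
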